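/- Let $G_{\mathcal P}$ be a directed graph (self-loops allowed) on $\{1,\dots,q\}$ with edge set $E_{\mathcal P}$ and adjacency matrix $S_{\mathcal P}$, where $(s_{\mathcal P})_{ij}=1$ if $(j,i)\in E_{\mathcal P}$ and $0$ otherwise. A node $i$ is a sink if there is no $j\neq i$ with $(i,j)\in E_{\mathcal P}$, and isolated if no edge in either direction joins it to another node. Let $(S_{\mathcal P})_{11}$ and $(S_{\mathcal P})_{22}$ be the submatrices of $S_{\mathcal P}$ whose rows and columns belong to the non-sinks and to the sinks, respectively. Let $G_{\mathcal K}$ be a directed graph on the same vertices containing all edges of $G_{\mathcal P}$, with adjacency matrix $S_{\mathcal K}$. Let $n_1,\dots,n_q\ge 1$, $n=\sum_i n_i$, and partition $n\times n$ matrices into blocks $M_{ij}\in\mathbb R^{n_i\times n_j}$. Let $\mathcal A$ (respectively $\mathcal K$) be the set of real $n\times n$ matrices $M$ with $M_{ij}=0$ whenever $(s_{\mathcal P})_{ij}=0$ (respectively $(s_{\mathcal K})_{ij}=0$). For $\epsilon>0$ let $\mathcal B(\epsilon)$ be the set of diagonal $n\times n$ matrices with all diagonal entries at least $\epsilon$,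 or else the set of block-diagonal matrices ($B_{ij}=0$ for $i\ne j$) whose smallest singular value is at least $\epsilon$; the assertion holds for either choice. A plant is a triple $P=(A,B,x_0)\in\mathcal P=\mathcal A\times\mathcal B(\epsilon)\times\mathbb R^n$. For a real $n\times n$ matrix $K$ let $$J_P(K)=\sum_{k=1}^\infty x(k)^Tx(k)+\sum_{k=0}^\infty u(k)^Tu(k)\in[0,\infty],\qquad x(0)=x_0,\quad u(k)=Kx(k),\quad x(k+1)=Ax(k)+Bu(k).$$ Let $J_P^*=\inf_{K\in\mathcal K}J_P(K)$, which equals $J_P(K^*(P))$ whenever an optimal controller $K^*(P)\in\mathcal K$ exists. The competitive ratio of a map $\Gamma:\mathcal A\times\mathcal B(\epsilon)\to\mathcal K$ is $$r_{\mathcal P}(\Gamma)=\sup_{P=(A,B,x_0)\in\mathcal P}\frac{J_P(\Gamma(A,B))}{J_P^*},\qquad \tfrac00:=1.$$ Let $\Gamma^\Theta(A,B)=-\operatorname{diag}(D_1,\dots,D_q)\,A$, where $D_i=B_{ii}^{-1}$ if $i$ is not a sink of $G_{\mathcal P}$, and $D_i=(I+B_{ii}^TX_{ii}B_{ii})^{-1}B_{ii}^TX_{ii}$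 if $i$ is a sink, $X_{ii}$ being the unique positive definite solution of $$A_{ii}^TX_{ii}B_{ii}(I+B_{ii}^TX_{ii}B_{ii})^{-1}B_{ii}^TX_{ii}A_{ii}-A_{ii}^TX_{ii}A_{ii}+X_{ii}-I=0.$$ Suppose that $G_{\mathcal P}$ has no isolated node and at least one sink. Then $$r_{\mathcal P}(\Gamma^\Theta)=\begin{cases}1,&\text{if }(S_{\mathcal P})_{11}=0\text{ and }(S_{\mathcal P})_{22}=0,\\ 1+1/\epsilon^2,&\text{if }(S_{\mathcal P})_{11}\neq0.\end{cases}$$ -/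

import Mathlib

open scoped ENNReal Matrix

namespace LimitedModelInfo

noncomputable section

/-- The state indices of an interconnection of `q` subsystems of orders `n 0, …, n (q - 1)`:
a state index is a subsystem together with an index inside that subsystem, so that the total
dimension is `∑ i, n i`. -/
abbrev Idx {q : ℕ} (n : Fin q → ℕ) : Type := (i : Fin q) × Fin (n i)

/-- Real square matrices acting on the state (or input) space of the whole interconnection. -/
abbrev Mat {q : ℕ} (n : Fin q → ℕ) : Type := Matrix (Idx n) (Idx n) ℝ

/-- The block `M_{ij}`, a real `n i × n j` matrix. -/
def block {q : ℕ} {n : Fin q → ℕ} (M : Mat n) (i j : Fin q) :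
    Matrix (Fin (n i)) (Fin (n j)) ℝ :=
  Matrix.of fun a b => M ⟨i, a⟩ ⟨j, b⟩

open Classical in
/-- The adjacency matrix of a directed graph: `s i j = 1` if `(j, i)` is an edge, and `0`
otherwise. -/
def adjacency {q : ℕ} (G : Digraph (Fin q)) : Matrix (Fin q) (Fin q) ℕ :=
  Matrix.of fun i j => if G.Adj j i then 1 else 0

/-- `i` is a sink: no edge leads from `i` to another vertex (a self-loop is allowed). -/
def IsSink {q : ℕ} (G : Digraph (Fin q)) (i : Fin q) : Prop :=
  ¬ ∃ j, j ≠ i ∧ G.Adj i j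

/-- `i` is isolated: no edge joins `i` to another vertex, in either direction. -/
def IsIsolated {q : ℕ} (G : Digraph (Fin q)) (i : Fin q) : Prop :=
  ¬ ∃ j, j ≠ i ∧ (G.Adj i j ∨ G.Adj j i)

/-- The block `S₁₁` of the adjacency matrix: rows and columns of the vertices that are not
sinks. -/
def adjacency11 {q : ℕ} (G : Digraph (Fin q)) :
    Matrix {i // ¬ IsSink G i} {i // ¬ IsSink G i} ℕ :=
  (adjacency G).toBlock (fun i => ¬ IsSink G i) (fun i => ¬ IsSink G i)

/-- The block `S₂₂` of the adjacency matrix: rows and columns of the sinks. -/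
def adjacency22 {q : ℕ} (G : Digraph (Fin q)) :
    Matrix {i // IsSink G i} {i // IsSink G i} ℕ :=
  (adjacency G).toBlock (IsSink G) (IsSink G)

/-- The matrices whose block `(i, j)` vanishes whenever the entry `(i, j)` of the adjacency
matrix of `G` does. For the plant graph this is the set `𝒜` of state matrices, for the control
graph it is the set `𝒦` of controllers. -/
def structured {q : ℕ} (n : Fin q → ℕ) (G : Digraph (Fin q)) : Set (Mat n) :=
  {M | ∀ i j, adjacency G i j = 0 → block M i j = 0}

/-- Block-diagonal input matrices all of whose singular values are at least `ε`. -/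
def blockInputs {q : ℕ} (n : Fin q → ℕ) (ε : ℝ) : Set (Mat n) :=
  {B | (∀ k < Fintype.card (Idx n), ε ≤ (Matrix.toEuclideanLin B).singularValues k) ∧
    ∀ i j, i ≠ j → block B i j = 0}

/-- Diagonal input matrices with all diagonal entries at least `ε`. -/
def diagonalInputs {q : ℕ} (n : Fin q → ℕ) (ε : ℝ) : Set (Mat n) :=
  {B | B.IsDiag ∧ ∀ s, ε ≤ B s s}

/-- A plant `x(k+1) = A x(k) + B u(k)`, `x(0) = x₀`. -/
structure Plant {q : ℕ} (n : Fin q → ℕ) where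
  A : Mat n
  B : Mat n
  x₀ : Idx n → ℝ

/-- The set of plants with state matrix structured by the graph `G` and input matrix in `𝓑`. -/
def plants {q : ℕ} (n : Fin q → ℕ) (G : Digraph (Fin q)) (𝓑 : Set (Mat n)) :
    Set (Plant n) :=
  {P | P.A ∈ structured n G ∧ P.B ∈ 𝓑}

/-- The closed-loop state of `P` under the static feedback `u(k) = K x(k)`. -/
def state {q : ℕ} {n : Fin q → ℕ} (P : Plant n) (K : Mat n) : ℕ → Idx n → ℝ
  | 0 => P.x₀
  | k + 1 => P.A *ᵥ state P K k + P.B *ᵥ (K *ᵥ state P K k)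

/-- The input `u(k) = K x(k)`. -/
def input {q : ℕ} {n : Fin q → ℕ} (P : Plant n) (K : Mat n) (k : ℕ) : Idx n → ℝ :=
  K *ᵥ state P K k

/-- The closed-loop cost `∑_{k ≥ 1} x(k)ᵀ x(k) + ∑_{k ≥ 0} u(k)ᵀ u(k)`, possibly `∞`. -/
def cost {q : ℕ} {n : Fin q → ℕ} (P : Plant n) (K : Mat n) : ℝ≥0∞ :=
  (∑' k : ℕ, ENNReal.ofReal (state P K (k + 1) ⬝ᵥ state P K (k + 1))) +
    ∑' k : ℕ, ENNReal.ofReal (input P K k ⬝ᵥ input P K k)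

/-- `K` is an optimal controller for `P` among the controllers structured by `G`. -/
def IsOptimal {q : ℕ} {n : Fin q → ℕ} (G : Digraph (Fin q)) (P : Plant n) (K : Mat n) : Prop :=
  K ∈ structured n G ∧ ∀ K' ∈ structured n G, cost P K ≤ cost P K'

/-- The optimal cost of `P` over the controllers structured by `G`; it is the cost of an optimal
controller whenever there is one, see `optimalCost_eq`. -/
def optimalCost {q : ℕ} {n : Fin q → ℕ} (G : Digraph (Fin q)) (P : Plant n) : ℝ≥0∞ :=
  ⨅ K ∈ structured n G, cost P K

theorem optimalCost_eq {q : ℕ} {n : Fin q → ℕ} {G : Digraph (Fin q)} {P : Plant n} {K : Mat n}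
    (h : IsOptimal G P K) : optimalCost G P = cost P K :=
  le_antisymm (iInf₂_le K h.1) (le_iInf₂ h.2)

open Classical in
/-- The quotient of two costs, with the convention that `0 / 0` is one. -/
def costRatio (a b : ℝ≥0∞) : ℝ≥0∞ :=
  if a = 0 ∧ b = 0 then 1 else a / b

/-- The competitive ratio of the control design method `Γ`, for the plant graph `GP`, the control
graph `GK` and the set `𝓑` of input matrices. -/
def competitiveRatio {q : ℕ} {n : Fin q → ℕ} (GP GK : Digraph (Fin q)) (𝓑 : Set (Mat n))
    (Γ : Mat n → Mat n → Mat n) : ℝ≥0∞ :=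
  ⨆ P ∈ plants n GP 𝓑, costRatio (cost P (Γ P.A P.B)) (optimalCost GK P)

/-- If every plant has an optimal controller `Kopt P`, the competitive ratio is the supremum of
the quotients of the cost of `Γ` by the cost of `Kopt P`. -/
theorem competitiveRatio_eq {q : ℕ} {n : Fin q → ℕ} {GP GK : Digraph (Fin q)}
    {𝓑 : Set (Mat n)} (Γ : Mat n → Mat n → Mat n) (Kopt : Plant n → Mat n)
    (h : ∀ P ∈ plants n GP 𝓑, IsOptimal GK P (Kopt P)) :
    competitiveRatio GP GK 𝓑 Γ =
      ⨆ P ∈ plants n GP 𝓑, costRatio (cost P (Γ P.A P.B)) (cost P (Kopt P)) :=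
  iSup_congr fun P => iSup_congr fun hP => by rw [optimalCost_eq (h P hP)]

/-- `X` solves the discrete algebraic Riccati equation
`Aᵀ X B (I + Bᵀ X B)⁻¹ Bᵀ X A - Aᵀ X A + X - I = 0`. -/
def IsRiccatiSolution {m : ℕ} (A B X : Matrix (Fin m) (Fin m) ℝ) : Prop :=
  Aᵀ * X * B * (1 + Bᵀ * X * B)⁻¹ * Bᵀ * X * A - Aᵀ * X * A + X - 1 = 0

/-- The positive definite solution of the discrete algebraic Riccati equation (it exists and is
unique whenever `B` is invertible). -/
def riccati {m : ℕ} (A B : Matrix (Fin m) (Fin m) ℝ) : Matrix (Fin m) (Fin m) ℝ :=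
  Classical.epsilon fun X => X.PosDef ∧ IsRiccatiSolution A B X

/-- The matrix `W_i(A, B) = (I + B_iiᵀ X_ii B_ii)⁻¹ B_iiᵀ X_ii`. -/
def sinkGain {q : ℕ} {n : Fin q → ℕ} (A B : Mat n) (i : Fin q) :
    Matrix (Fin (n i)) (Fin (n i)) ℝ :=
  (1 + (block B i i)ᵀ * riccati (block A i i) (block B i i) * block B i i)⁻¹ *
    (block B i i)ᵀ * riccati (block A i i) (block B i i)

open Classical in
/-- The design method `Γ^Θ(A, B) = -diag(D_1, …, D_q) A`, where `D_i = W_i(A, B)` if `i` is a sink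
of `G` and `D_i = B_ii⁻¹` otherwise. -/
def thetaMethod {q : ℕ} {n : Fin q → ℕ} (G : Digraph (Fin q)) (A B : Mat n) : Mat n :=
  -(Matrix.blockDiagonal' (fun i => if IsSink G i then sinkGain A B i else (block B i i)⁻¹) * A)

/-- `Γ^Θ` produces admissible controllers if the control graph contains the plant graph. -/
theorem thetaMethod_mem {q : ℕ} {n : Fin q → ℕ} {GP GK : Digraph (Fin q)} (hGK : GP ≤ GK)
    {A : Mat n} (hA : A ∈ structured n GP) (B : Mat n) :
    thetaMethod GP A B ∈ structured n GK := by
  intro i j hij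
  have hz : block A i j = 0 := by
    apply hA
    have h1 : ¬ GK.Adj j i := by simpa [adjacency] using hij
    simpa [adjacency] using fun h => h1 (hGK h)
  ext a b
  simp only [block, thetaMethod, Matrix.of_apply, Matrix.neg_apply, Matrix.mul_apply,
    Matrix.zero_apply, neg_eq_zero]
  refine Finset.sum_eq_zero ?_
  rintro ⟨k, c⟩ -
  by_cases hk : i = k
  · subst hk
    have : A ⟨i, c⟩ ⟨j, b⟩ = 0 := congrFun (congrFun hz c) b
    rw [this, mul_zero]
  · rw [Matrix.blockDiagonal'_apply_ne _ _ _ hk, zero_mul]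

end

end LimitedModelInfo

namespace LimitedModelInfo

/-! Write `y = A x₀`. Under `Γ^Θ` every non-sink is deadbeat: its state vanishes from time 1 on.
Sinks send nothing to other subsystems, so from then on each sink runs alone under its own LQR gain.
Hence (`theta_step`, `theta_cost_le`) the cost is at most a sum over subsystems: `|B_ii⁻¹ y_i|²` for
a non-sink, the Riccati value of `y_i` for a sink. Any controller pays at least its first stage `∑
|y_i + B_ii u_i|² + |u_i|²` (`le_cost`), so the comparison is made block by block
(`theta_costRatio_le`).

For the bound `1 + 1/ε²`, the sink value is at most the deadbeat value, and `inv_mulVec_le` compares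
the latter with one stage. It is sharp: with one link of gain `s` into a non-sink and `B = ε I`,
`Γ^Θ` pays at least `s²/ε²`, while the one-stage optimal gain pays about `s²/(1 + ε²)` as `s → 0`.

If `S₁₁ = 0` and `S₂₂ = 0`, then `y_i = 0` at non-sinks, while `A_ii = 0` and `X_ii = I` at sinks,
so `Γ^Θ` attains the one-stage minimum. -/

theorem dotProduct_self_nonneg {ι : Type*} [Fintype ι] (x : ι → ℝ) : 0 ≤ x ⬝ᵥ x :=
  Finset.sum_nonneg fun _ _ => mul_self_nonneg _

/-! ### Completion of squares and existence of Riccati solutions -/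

section Riccati

variable {m : ℕ}

/-- The feedback gain `(I + Bᵀ X B)⁻¹ Bᵀ X` of the cost-to-go matrix `X`. -/
noncomputable def feedbackGain (B X : Matrix (Fin m) (Fin m) ℝ) : Matrix (Fin m) (Fin m) ℝ :=
  (1 + Bᵀ * X * B)⁻¹ * Bᵀ * X

/-- The matrix of the quadratic form `y ↦ min_u (y + B u)ᵀ X (y + B u) + uᵀ u`. -/
noncomputable def valueMatrix (B X : Matrix (Fin m) (Fin m) ℝ) : Matrix (Fin m) (Fin m) ℝ :=
  X - X * B * (1 + Bᵀ * X * B)⁻¹ * Bᵀ * X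

theorem isRiccatiSolution_iff {A B X : Matrix (Fin m) (Fin m) ℝ} :
    IsRiccatiSolution A B X ↔ X = 1 + Aᵀ * valueMatrix B X * A := by
  have h : Aᵀ * X * B * (1 + Bᵀ * X * B)⁻¹ * Bᵀ * X * A - Aᵀ * X * A + X - 1 =
      X - (1 + Aᵀ * valueMatrix B X * A) := by
    simp only [valueMatrix, mul_sub, sub_mul, mul_assoc]
    abel
  rw [IsRiccatiSolution, h, sub_eq_zero]

theorem dotProduct_mulVec_symm {M : Matrix (Fin m) (Fin m) ℝ} (hM : Mᵀ = M) (x y : Fin m → ℝ) :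
    x ⬝ᵥ M *ᵥ y = y ⬝ᵥ M *ᵥ x := by
  rw [Matrix.dotProduct_mulVec, ← Matrix.mulVec_transpose, hM, dotProduct_comm]

theorem mulVec_dotProduct_left (M : Matrix (Fin m) (Fin m) ℝ) (x y : Fin m → ℝ) :
    (M *ᵥ x) ⬝ᵥ y = x ⬝ᵥ Mᵀ *ᵥ y := by
  rw [Matrix.dotProduct_mulVec, Matrix.vecMul_transpose]

theorem transpose_eq_of_posDef {X : Matrix (Fin m) (Fin m) ℝ} (hX : X.PosDef) : Xᵀ = X := by
  simpa [Matrix.conjTranspose_eq_transpose_of_trivial] using hX.isHermitian.eq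

theorem posDef_one_add {X : Matrix (Fin m) (Fin m) ℝ} (hX : X.PosDef)
    (B : Matrix (Fin m) (Fin m) ℝ) : (1 + Bᵀ * X * B).PosDef := by
  refine Matrix.PosDef.one.add_posSemidef ?_
  simpa [Matrix.conjTranspose_eq_transpose_of_trivial] using
    hX.posSemidef.conjTranspose_mul_mul_same B

theorem one_add_mul_feedbackGain {X : Matrix (Fin m) (Fin m) ℝ} (hX : X.PosDef)
    (B : Matrix (Fin m) (Fin m) ℝ) :
    (1 + Bᵀ * X * B) * feedbackGain B X = Bᵀ * X := by
  have hu : IsUnit (1 + Bᵀ * X * B).det := (posDef_one_add hX B).det_pos.ne'.isUnit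
  rw [feedbackGain, mul_assoc _ Bᵀ X, Matrix.mul_nonsing_inv_cancel_left _ _ hu]

/-- The gain solves the normal equation `(1 + Bᵀ X B) W = Bᵀ X`, so all cross terms in `u` and `y`
are absorbed into one square, which vanishes at the minimiser `u = -W y`. -/
theorem complete_square {X : Matrix (Fin m) (Fin m) ℝ} (hX : X.PosDef)
    (B : Matrix (Fin m) (Fin m) ℝ) (y u : Fin m → ℝ) :
    (y + B *ᵥ u) ⬝ᵥ X *ᵥ (y + B *ᵥ u) + u ⬝ᵥ u =
      y ⬝ᵥ valueMatrix B X *ᵥ y +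
        (u + feedbackGain B X *ᵥ y) ⬝ᵥ
          (1 + Bᵀ * X * B) *ᵥ (u + feedbackGain B X *ᵥ y) := by
  have hXt := transpose_eq_of_posDef hX
  have hN := transpose_eq_of_posDef (posDef_one_add hX B)
  have hNW := one_add_mul_feedbackGain hX B
  have hG : valueMatrix B X = X - X * B * feedbackGain B X := by
    simp only [valueMatrix, feedbackGain, mul_assoc]
  set W := feedbackGain B X with hW
  have hNWy : (1 + Bᵀ * X * B) *ᵥ W *ᵥ y = Bᵀ *ᵥ X *ᵥ y := by
    rw [Matrix.mulVec_mulVec, hNW, Matrix.mulVec_mulVec]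
  have e1 : (W *ᵥ y) ⬝ᵥ (1 + Bᵀ * X * B) *ᵥ u = u ⬝ᵥ Bᵀ *ᵥ X *ᵥ y := by
    rw [dotProduct_mulVec_symm hN, hNWy]
  have e2 : (B *ᵥ u) ⬝ᵥ X *ᵥ y = u ⬝ᵥ Bᵀ *ᵥ X *ᵥ y := mulVec_dotProduct_left _ _ _
  have e3 : y ⬝ᵥ X *ᵥ B *ᵥ u = u ⬝ᵥ Bᵀ *ᵥ X *ᵥ y := by
    rw [dotProduct_mulVec_symm hXt, e2]
  have e4 : y ⬝ᵥ X *ᵥ B *ᵥ W *ᵥ y = (W *ᵥ y) ⬝ᵥ Bᵀ *ᵥ X *ᵥ y := by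
    rw [dotProduct_mulVec_symm hXt, mulVec_dotProduct_left]
  have e5 : u ⬝ᵥ (1 + Bᵀ * X * B) *ᵥ u = u ⬝ᵥ u + (B *ᵥ u) ⬝ᵥ X *ᵥ B *ᵥ u := by
    rw [Matrix.add_mulVec, Matrix.one_mulVec, dotProduct_add, mulVec_dotProduct_left]
    simp only [Matrix.mulVec_mulVec, mul_assoc]
  rw [hG]
  simp only [Matrix.sub_mulVec, Matrix.mulVec_add, dotProduct_add, add_dotProduct, dotProduct_sub,
    ← Matrix.mulVec_mulVec (M := X * B), ← Matrix.mulVec_mulVec (M := X) (N := B), hNWy, e1, e2, e3,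
    e4, e5]
  ring

theorem valueMatrix_le {X : Matrix (Fin m) (Fin m) ℝ} (hX : X.PosDef)
    (B : Matrix (Fin m) (Fin m) ℝ) (y u : Fin m → ℝ) :
    y ⬝ᵥ valueMatrix B X *ᵥ y ≤ (y + B *ᵥ u) ⬝ᵥ X *ᵥ (y + B *ᵥ u) + u ⬝ᵥ u := by
  rw [complete_square hX]
  have := (posDef_one_add hX B).posSemidef.dotProduct_mulVec_nonneg (u + feedbackGain B X *ᵥ y)
  rw [star_trivial] at this
  linarith

theorem valueMatrix_eq {X : Matrix (Fin m) (Fin m) ℝ} (hX : X.PosDef)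
    (B : Matrix (Fin m) (Fin m) ℝ) (y : Fin m → ℝ) :
    y ⬝ᵥ valueMatrix B X *ᵥ y =
      (y - B *ᵥ feedbackGain B X *ᵥ y) ⬝ᵥ X *ᵥ (y - B *ᵥ feedbackGain B X *ᵥ y) +
        (feedbackGain B X *ᵥ y) ⬝ᵥ (feedbackGain B X *ᵥ y) := by
  have := complete_square hX B y (-(feedbackGain B X *ᵥ y))
  simp only [Matrix.mulVec_neg, ← sub_eq_add_neg, neg_dotProduct, dotProduct_neg, neg_neg,
    neg_add_cancel, zero_dotProduct, add_zero] at this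
  exact this.symm

theorem valueMatrix_nonneg {X : Matrix (Fin m) (Fin m) ℝ} (hX : X.PosDef)
    (B : Matrix (Fin m) (Fin m) ℝ) (y : Fin m → ℝ) : 0 ≤ y ⬝ᵥ valueMatrix B X *ᵥ y := by
  rw [valueMatrix_eq hX]
  have := hX.posSemidef.dotProduct_mulVec_nonneg (y - B *ᵥ feedbackGain B X *ᵥ y)
  rw [star_trivial] at this
  have h2 : 0 ≤ (feedbackGain B X *ᵥ y) ⬝ᵥ (feedbackGain B X *ᵥ y) := dotProduct_self_nonneg _
  linarith

/-- The deadbeat input `-B⁻¹ y` competes in the minimum and leaves only its own energy. -/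
theorem valueMatrix_le_inv {X B : Matrix (Fin m) (Fin m) ℝ} (hX : X.PosDef)
    (hB : IsUnit B.det) (y : Fin m → ℝ) :
    y ⬝ᵥ valueMatrix B X *ᵥ y ≤ (B⁻¹ *ᵥ y) ⬝ᵥ (B⁻¹ *ᵥ y) := by
  have := valueMatrix_le hX B y (-(B⁻¹ *ᵥ y))
  simpa [Matrix.mulVec_neg, Matrix.mulVec_mulVec, Matrix.mul_nonsing_inv _ hB] using this

theorem valueMatrix_transpose {X : Matrix (Fin m) (Fin m) ℝ} (hX : X.PosDef)
    (B : Matrix (Fin m) (Fin m) ℝ) : (valueMatrix B X)ᵀ = valueMatrix B X := by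
  have hXt := transpose_eq_of_posDef hX
  have hN := transpose_eq_of_posDef (posDef_one_add hX B)
  set N := 1 + Bᵀ * X * B with hN_def
  have hV : valueMatrix B X = X - X * B * N⁻¹ * Bᵀ * X := rfl
  simp only [hV, Matrix.transpose_sub, Matrix.transpose_mul, Matrix.transpose_nonsing_inv,
    hN, hXt, Matrix.transpose_transpose, mul_assoc]

theorem dotProduct_riccatiMap (A G : Matrix (Fin m) (Fin m) ℝ) (y : Fin m → ℝ) :
    y ⬝ᵥ (1 + Aᵀ * G * A) *ᵥ y = y ⬝ᵥ y + (A *ᵥ y) ⬝ᵥ G *ᵥ (A *ᵥ y) := by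
  rw [Matrix.add_mulVec, Matrix.one_mulVec, dotProduct_add, mulVec_dotProduct_left]
  simp only [Matrix.mulVec_mulVec, mul_assoc]

/-- The symmetric matrices `X ≥ I` that are at most their image under the Riccati map. -/
def riccatiSub (A B : Matrix (Fin m) (Fin m) ℝ) : Set (Matrix (Fin m) (Fin m) ℝ) :=
  {X | Xᵀ = X ∧ (∀ y, y ⬝ᵥ y ≤ y ⬝ᵥ X *ᵥ y) ∧
    ∀ y u, y ⬝ᵥ X *ᵥ y ≤ y ⬝ᵥ y + ((A *ᵥ y + B *ᵥ u) ⬝ᵥ X *ᵥ (A *ᵥ y + B *ᵥ u) + u ⬝ᵥ u)}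

theorem posDef_of_le {X : Matrix (Fin m) (Fin m) ℝ} (hX : Xᵀ = X)
    (h : ∀ y, y ⬝ᵥ y ≤ y ⬝ᵥ X *ᵥ y) : X.PosDef := by
  refine Matrix.PosDef.of_dotProduct_mulVec_pos ?_ fun x hx => ?_
  · rw [Matrix.IsHermitian, Matrix.conjTranspose_eq_transpose_of_trivial, hX]
  · rw [star_trivial]
    have h0 : 0 < x ⬝ᵥ x :=
      lt_of_le_of_ne (dotProduct_self_nonneg x) fun h => hx (dotProduct_self_eq_zero.1 h.symm)
    exact h0.trans_le (h x)

theorem one_mem_riccatiSub (A B : Matrix (Fin m) (Fin m) ℝ) : 1 ∈ riccatiSub A B := by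
  refine ⟨Matrix.transpose_one, fun y => by rw [Matrix.one_mulVec], fun y u => ?_⟩
  simp only [Matrix.one_mulVec]
  have h1 := dotProduct_self_nonneg (A *ᵥ y + B *ᵥ u)
  have h2 := dotProduct_self_nonneg u
  linarith

theorem isClosed_riccatiSub (A B : Matrix (Fin m) (Fin m) ℝ) : IsClosed (riccatiSub A B) := by
  have hc : ∀ y : Fin m → ℝ, Continuous fun X : Matrix (Fin m) (Fin m) ℝ => y ⬝ᵥ X *ᵥ y :=
    fun y => continuous_const.dotProduct (continuous_id.matrix_mulVec continuous_const)
  have h1 : IsClosed {X : Matrix (Fin m) (Fin m) ℝ | Xᵀ = X} :=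
    isClosed_eq continuous_id.matrix_transpose continuous_id
  have h2 : IsClosed {X : Matrix (Fin m) (Fin m) ℝ | ∀ y, y ⬝ᵥ y ≤ y ⬝ᵥ X *ᵥ y} := by
    rw [Set.ofPred_forall]
    exact isClosed_iInter fun y => isClosed_le continuous_const (hc y)
  have h3 : IsClosed {X : Matrix (Fin m) (Fin m) ℝ | ∀ y u, y ⬝ᵥ X *ᵥ y ≤
      y ⬝ᵥ y + ((A *ᵥ y + B *ᵥ u) ⬝ᵥ X *ᵥ (A *ᵥ y + B *ᵥ u) + u ⬝ᵥ u)} := by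
    simp only [Set.ofPred_forall]
    exact isClosed_iInter fun y => isClosed_iInter fun u =>
      isClosed_le (hc y) (continuous_const.add ((hc _).add continuous_const))
  exact h1.inter (h2.inter h3)

/-- Evaluate the form at `e_i ± e_j`. Bounded diagonals thus bound the whole matrix, as compactness
requires. -/
theorem entry_le {X : Matrix (Fin m) (Fin m) ℝ} (hX : Xᵀ = X)
    (h : ∀ y, 0 ≤ y ⬝ᵥ X *ᵥ y) (i j : Fin m) : 2 * |X i j| ≤ X i i + X j j := by
  have hs : X j i = X i j := congrFun (congrFun hX i) j
  have h1 := h (Pi.single i 1 + Pi.single j 1)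
  have h2 := h (Pi.single i 1 - Pi.single j 1)
  simp only [Matrix.mulVec_add, Matrix.mulVec_sub, add_dotProduct, sub_dotProduct, dotProduct_add,
    dotProduct_sub, Matrix.mulVec_single_one, single_one_dotProduct, Matrix.col_apply, hs] at h1 h2
  rcases abs_cases (X i j) with ⟨h3, -⟩ | ⟨h3, -⟩ <;> rw [h3] <;> linarith

theorem isCompact_riccatiSub (A : Matrix (Fin m) (Fin m) ℝ) {B : Matrix (Fin m) (Fin m) ℝ}
    (hB : IsUnit B.det) : IsCompact (riccatiSub A B) := by
  let c : Fin m → ℝ := fun i => (Pi.single i 1 : Fin m → ℝ) ⬝ᵥ Pi.single i 1 +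
    (B⁻¹ *ᵥ A *ᵥ Pi.single i 1) ⬝ᵥ (B⁻¹ *ᵥ A *ᵥ Pi.single i 1)
  have hK : IsCompact (Set.univ.pi fun i : Fin m => Set.univ.pi fun j : Fin m =>
      Set.Icc (-((c i + c j) / 2)) ((c i + c j) / 2)) :=
    isCompact_univ_pi fun i => isCompact_univ_pi fun j => isCompact_Icc
  refine hK.of_isClosed_subset (isClosed_riccatiSub A B) ?_
  intro X hX
  change Matrix (Fin m) (Fin m) ℝ at X
  obtain ⟨hXt, h1, h2⟩ := hX
  have hd : ∀ i, X i i ≤ c i := fun i => by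
    -- The deadbeat input makes the right-hand side independent of `X`; this is where `c` comes
    -- from.
    have := h2 (Pi.single i 1) (-(B⁻¹ *ᵥ A *ᵥ Pi.single i 1))
    rw [Matrix.mulVec_neg, Matrix.mulVec_mulVec _ B, Matrix.mul_nonsing_inv _ hB, Matrix.one_mulVec,
      add_neg_cancel, zero_dotProduct, zero_add, neg_dotProduct_neg] at this
    simpa [c] using this
  intro i _ j _
  have h3 := entry_le hXt (fun y => (dotProduct_self_nonneg y).trans (h1 y)) i j
  have h4 := hd i
  have h5 := hd j
  exact Set.mem_Icc.2 (abs_le.1 (by linarith))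

/-- A subsolution `X` of maximal trace is a fixed point of the Riccati map: its image `F` dominates
`X` and is again a subsolution, so `F - X` is positive semidefinite with trace zero. -/
theorem exists_riccati (A : Matrix (Fin m) (Fin m) ℝ) {B : Matrix (Fin m) (Fin m) ℝ}
    (hB : IsUnit B.det) : ∃ X : Matrix (Fin m) (Fin m) ℝ, X.PosDef ∧ IsRiccatiSolution A B X := by
  obtain ⟨X, hX, hmax⟩ := (isCompact_riccatiSub A hB).exists_isMaxOn ⟨1, one_mem_riccatiSub A B⟩
    (continuous_id.matrix_trace).continuousOn
  obtain ⟨hXt, h1, h2⟩ := hX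
  have hP := posDef_of_le hXt h1
  set F := 1 + Aᵀ * valueMatrix B X * A with hF
  have hFy : ∀ y, y ⬝ᵥ F *ᵥ y = y ⬝ᵥ y + (A *ᵥ y) ⬝ᵥ valueMatrix B X *ᵥ (A *ᵥ y) :=
    dotProduct_riccatiMap A _
  have hXF : ∀ y, y ⬝ᵥ X *ᵥ y ≤ y ⬝ᵥ F *ᵥ y := fun y => by
    rw [hFy, valueMatrix_eq hP]
    -- The minimising input turns the subsolution inequality into `X ≤ F`.
    have := h2 y (-(feedbackGain B X *ᵥ A *ᵥ y))
    rwa [Matrix.mulVec_neg, ← sub_eq_add_neg, neg_dotProduct_neg] at this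
  have hFt : Fᵀ = F := by
    simp only [hF, Matrix.transpose_add, Matrix.transpose_one, Matrix.transpose_mul,
      valueMatrix_transpose hP, Matrix.transpose_transpose, mul_assoc]
  have hFS : F ∈ riccatiSub A B := by
    refine ⟨hFt, fun y => (h1 y).trans (hXF y), fun y u => ?_⟩
    rw [hFy]
    have h3 := valueMatrix_le hP B (A *ᵥ y) u
    have h4 := hXF (A *ᵥ y + B *ᵥ u)
    linarith
  have htr : F.trace ≤ X.trace := hmax hFS
  have hpsd : (F - X).PosSemidef := by
    refine Matrix.PosSemidef.of_dotProduct_mulVec_nonneg ?_ fun x => ?_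
    · rw [Matrix.IsHermitian, Matrix.conjTranspose_eq_transpose_of_trivial, Matrix.transpose_sub,
        hFt, hXt]
    · rw [star_trivial, Matrix.sub_mulVec, dotProduct_sub]
      exact sub_nonneg.2 (hXF x)
  have h0 : (F - X).trace = 0 :=
    le_antisymm (by rw [Matrix.trace_sub]; linarith) hpsd.trace_nonneg
  have : F - X = 0 := hpsd.trace_eq_zero_iff.1 h0
  exact ⟨X, hP, isRiccatiSolution_iff.2 (sub_eq_zero.1 this).symm⟩

/-- Existence suffices: the later arguments use only these two properties, never uniqueness. -/
theorem riccati_spec (A : Matrix (Fin m) (Fin m) ℝ) {B : Matrix (Fin m) (Fin m) ℝ}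
    (hB : IsUnit B.det) : (riccati A B).PosDef ∧ IsRiccatiSolution A B (riccati A B) :=
  Classical.epsilon_spec (exists_riccati A hB)

theorem riccati_zero {B : Matrix (Fin m) (Fin m) ℝ} (hB : IsUnit B.det) : riccati 0 B = 1 := by
  simpa using isRiccatiSolution_iff.1 (riccati_spec 0 hB).2

theorem riccati_form {A B : Matrix (Fin m) (Fin m) ℝ} (hB : IsUnit B.det) (y : Fin m → ℝ) :
    y ⬝ᵥ riccati A B *ᵥ y =
      y ⬝ᵥ y + (A *ᵥ y) ⬝ᵥ valueMatrix B (riccati A B) *ᵥ (A *ᵥ y) := by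
  conv_lhs => rw [isRiccatiSolution_iff.1 (riccati_spec A hB).2]
  exact dotProduct_riccatiMap A _ y

end Riccati

end LimitedModelInfo

namespace LimitedModelInfo

/-! ### The two classes of input matrices -/

section InputMatrices

open Module in
-- Expand `v` in an orthonormal eigenbasis of `T* T`, whose eigenvalues are the squared singular
-- values.
theorem sq_mul_norm_sq_le_of_singularValues {E F : Type*} [NormedAddCommGroup E]
    [InnerProductSpace ℝ E] [FiniteDimensional ℝ E] [NormedAddCommGroup F]
    [InnerProductSpace ℝ F] [FiniteDimensional ℝ F] (T : E →ₗ[ℝ] F) {ε : ℝ} (hε : 0 ≤ ε)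
    (h : ∀ k < finrank ℝ E, ε ≤ T.singularValues k) (v : E) :
    ε ^ 2 * ‖v‖ ^ 2 ≤ ‖T v‖ ^ 2 := by
  have hS := T.isSymmetric_adjoint_comp_self
  have h1 : ‖T v‖ ^ 2 = inner ℝ v ((T.adjoint ∘ₗ T) v) := by
    rw [LinearMap.comp_apply, LinearMap.adjoint_inner_right, real_inner_self_eq_norm_sq]
  set b := hS.eigenvectorBasis rfl with hb
  have h2 : ∀ i, inner ℝ (b i) ((T.adjoint ∘ₗ T) v) =
      T.singularValues i ^ 2 * inner ℝ (b i) v := fun i => by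
    rw [T.sq_singularValues_fin rfl i, ← hS, hb, hS.apply_eigenvectorBasis rfl i, inner_smul_left]
    simp
  rw [h1, ← b.sum_inner_mul_inner, ← b.sum_sq_norm_inner_right v, Finset.mul_sum]
  refine Finset.sum_le_sum fun i _ => ?_
  rw [h2, real_inner_comm, Real.norm_eq_abs, sq_abs]
  have h3 : ε ^ 2 ≤ T.singularValues i ^ 2 := pow_le_pow_left₀ hε (h i i.2) 2
  nlinarith [mul_le_mul_of_nonneg_right h3 (sq_nonneg (inner ℝ (b i) v))]

open Module in
theorem singularValues_smul_id {E : Type*} [NormedAddCommGroup E] [InnerProductSpace ℝ E]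
    [FiniteDimensional ℝ E] {ε : ℝ} (hε : 0 ≤ ε) {k : ℕ} (hk : k < finrank ℝ E) :
    (ε • LinearMap.id : E →ₗ[ℝ] E).singularValues k = ε := by
  have h := (ε • LinearMap.id : E →ₗ[ℝ] E).hasEigenvalue_adjoint_comp_self_sq_singularValues hk
  obtain ⟨v, hv⟩ := h.exists_hasEigenvector
  have h1 := hv.apply_eq_smul
  have h2 : (LinearMap.adjoint (ε • LinearMap.id : E →ₗ[ℝ] E) ∘ₗ (ε • LinearMap.id)) v =
      ε ^ 2 • v := by
    simp [smul_smul, sq]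
  rw [h2] at h1
  have h3 := smul_left_injective ℝ hv.2 h1
  exact ((sq_eq_sq₀ hε (LinearMap.singularValues_nonneg _ _)).1 h3).symm

variable {q : ℕ} {n : Fin q → ℕ}

theorem isDiag_block {B : Mat n} (hB : B.IsDiag) {i j : Fin q} (hij : i ≠ j) : block B i j = 0 := by
  ext a b
  exact hB fun h => hij (congrArg Sigma.fst h)

theorem dotProduct_eq_norm_sq {ι : Type*} [Fintype ι] (v : ι → ℝ) :
    v ⬝ᵥ v = ‖(WithLp.toLp 2 v : EuclideanSpace ℝ ι)‖ ^ 2 := by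
  rw [EuclideanSpace.real_norm_sq_eq]
  simp [dotProduct, sq]

/-- Both choices of the set of input matrices consist of block-diagonal matrices that expand the
Euclidean norm by the factor `ε` at least. -/
theorem inputs_spec {ε : ℝ} (hε : 0 < ε) {𝓑 : Set (Mat n)}
    (h𝓑 : 𝓑 = blockInputs n ε ∨ 𝓑 = diagonalInputs n ε) {B : Mat n} (hB : B ∈ 𝓑) :
    (∀ i j, i ≠ j → block B i j = 0) ∧ ∀ v, ε ^ 2 * (v ⬝ᵥ v) ≤ (B *ᵥ v) ⬝ᵥ (B *ᵥ v) := by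
  rcases h𝓑 with rfl | rfl
  · refine ⟨hB.2, fun v => ?_⟩
    have := sq_mul_norm_sq_le_of_singularValues (Matrix.toEuclideanLin B) hε.le
      (by simpa using hB.1) (WithLp.toLp 2 v)
    rwa [Matrix.toLpLin_toLp, ← dotProduct_eq_norm_sq, ← dotProduct_eq_norm_sq] at this
  · refine ⟨fun i j => isDiag_block hB.1, fun v => ?_⟩
    rw [← hB.1.diagonal_diag]
    simp only [dotProduct, Matrix.mulVec_diagonal, Matrix.diag_apply, Finset.mul_sum]
    refine Finset.sum_le_sum fun s _ => ?_
    have h3 : ε ^ 2 ≤ B s s ^ 2 := pow_le_pow_left₀ hε.le (hB.2 s) 2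
    nlinarith [mul_le_mul_of_nonneg_right h3 (mul_self_nonneg (v s))]

/-- Makes the extremal choice `B = ε I` available in both classes. -/
theorem smul_one_mem_inputs {ε : ℝ} (hε : 0 < ε) {𝓑 : Set (Mat n)}
    (h𝓑 : 𝓑 = blockInputs n ε ∨ 𝓑 = diagonalInputs n ε) : ε • (1 : Mat n) ∈ 𝓑 := by
  have hd : (ε • (1 : Mat n)).IsDiag := Matrix.isDiag_one.smul ε
  rcases h𝓑 with rfl | rfl
  · refine ⟨fun k hk => ?_, fun i j => isDiag_block hd⟩
    have h1 : Matrix.toEuclideanLin (ε • (1 : Mat n)) = ε • LinearMap.id := by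
      ext; simp
    rw [h1, singularValues_smul_id hε.le (by simpa using hk)]
  · exact ⟨hd, fun s => by simp⟩

end InputMatrices

/-! ### Decomposition into subsystems -/

section Blocks

variable {q : ℕ} {n : Fin q → ℕ}

/-- The component of a vector that belongs to a subsystem. -/
def part (x : Idx n → ℝ) (i : Fin q) : Fin (n i) → ℝ := fun a => x ⟨i, a⟩

theorem part_add (x y : Idx n → ℝ) (i : Fin q) : part (x + y) i = part x i + part y i := rfl

theorem part_neg (x : Idx n → ℝ) (i : Fin q) : part (-x) i = -part x i := rfl

theorem dotProduct_eq_sum_part (x y : Idx n → ℝ) :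
    x ⬝ᵥ y = ∑ i, part x i ⬝ᵥ part y i := by
  simp only [dotProduct, part, Fintype.sum_sigma]

theorem part_mulVec (M : Mat n) (x : Idx n → ℝ) (i : Fin q) :
    part (M *ᵥ x) i = ∑ j, block M i j *ᵥ part x j := by
  ext a
  simp only [part, block, Matrix.mulVec, dotProduct, Fintype.sum_sigma, Finset.sum_apply,
    Matrix.of_apply]

theorem part_mulVec_of_block_eq_zero {M : Mat n} {i : Fin q} (x : Idx n → ℝ)
    (h : ∀ j, j ≠ i → block M i j *ᵥ part x j = 0) :
    part (M *ᵥ x) i = block M i i *ᵥ part x i := by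
  rw [part_mulVec]
  exact Finset.sum_eq_single i (fun j _ hj => h j hj) (by simp)

theorem part_mulVec_of_blockDiagonal {M : Mat n} (h : ∀ i j, i ≠ j → block M i j = 0)
    (x : Idx n → ℝ) (i : Fin q) : part (M *ᵥ x) i = block M i i *ᵥ part x i :=
  part_mulVec_of_block_eq_zero x fun j hj => by rw [h i j hj.symm, Matrix.zero_mulVec]

theorem part_blockDiagonal'_mulVec (D : ∀ i, Matrix (Fin (n i)) (Fin (n i)) ℝ) (x : Idx n → ℝ)
    (i : Fin q) : part (Matrix.blockDiagonal' D *ᵥ x) i = D i *ᵥ part x i := by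
  rw [part_mulVec_of_blockDiagonal]
  · congr 1
    ext a b
    exact Matrix.blockDiagonal'_apply_eq D i a b
  · intro i j hij
    ext a b
    exact Matrix.blockDiagonal'_apply_ne D a b hij

theorem block_bound {B : Mat n} {ε : ℝ} (hB : ∀ i j, i ≠ j → block B i j = 0)
    (h : ∀ v, ε ^ 2 * (v ⬝ᵥ v) ≤ (B *ᵥ v) ⬝ᵥ (B *ᵥ v)) (i : Fin q) (w : Fin (n i) → ℝ) :
    ε ^ 2 * (w ⬝ᵥ w) ≤ (block B i i *ᵥ w) ⬝ᵥ (block B i i *ᵥ w) := by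
  -- The extension of `w` by zero to the other subsystems.
  let v : Idx n → ℝ := fun s => (Pi.single i w : ∀ j, Fin (n j) → ℝ) s.1 s.2
  have hv : ∀ j, part v j = (Pi.single i w : ∀ j, Fin (n j) → ℝ) j := fun j => rfl
  have h1 := h v
  rw [dotProduct_eq_sum_part, dotProduct_eq_sum_part,
    Finset.sum_eq_single i (fun j _ hj => by simp [hv, hj]) (by simp),
    Finset.sum_eq_single i (fun j _ hj => by
      rw [part_mulVec_of_blockDiagonal hB]; simp [hv, hj]) (by simp),
    part_mulVec_of_blockDiagonal hB] at h1
  simpa [hv] using h1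

theorem isUnit_det_of_bound {m : ℕ} {B : Matrix (Fin m) (Fin m) ℝ} {ε : ℝ} (hε : 0 < ε)
    (h : ∀ w, ε ^ 2 * (w ⬝ᵥ w) ≤ (B *ᵥ w) ⬝ᵥ (B *ᵥ w)) : IsUnit B.det := by
  refine isUnit_iff_ne_zero.2 fun h0 => ?_
  obtain ⟨w, hw, hBw⟩ := Matrix.exists_mulVec_eq_zero_iff.2 h0
  have h1 := h w
  rw [hBw, zero_dotProduct] at h1
  refine hw (dotProduct_self_eq_zero.1 (le_antisymm ?_ (dotProduct_self_nonneg w)))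
  have : 0 < ε ^ 2 := by positivity
  nlinarith

/-- With `y = B z`, replace `|B (z + u)|²` by `ε² |z + u|²`; the remaining gap is the square `ε⁻²
|ε² (z + u) + u|²`. -/
theorem inv_mulVec_le {m : ℕ} {B : Matrix (Fin m) (Fin m) ℝ} {ε : ℝ} (hε : 0 < ε)
    (h : ∀ w, ε ^ 2 * (w ⬝ᵥ w) ≤ (B *ᵥ w) ⬝ᵥ (B *ᵥ w)) (y u : Fin m → ℝ) :
    (B⁻¹ *ᵥ y) ⬝ᵥ (B⁻¹ *ᵥ y) ≤
      (1 + 1 / ε ^ 2) * ((y + B *ᵥ u) ⬝ᵥ (y + B *ᵥ u) + u ⬝ᵥ u) := by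
  have hB := isUnit_det_of_bound hε h
  set z := B⁻¹ *ᵥ y with hz
  have hy : y = B *ᵥ z := by
    rw [hz, Matrix.mulVec_mulVec, Matrix.mul_nonsing_inv _ hB, Matrix.one_mulVec]
  have h1 := h (z + u)
  rw [hy, ← Matrix.mulVec_add]
  have hc : 0 < 1 + 1 / ε ^ 2 := by positivity
  refine le_trans ?_ (mul_le_mul_of_nonneg_left (add_le_add_left h1 _) hc.le)
  have h2 := dotProduct_self_nonneg (ε ^ 2 • (z + u) + u)
  have h3 : (1 + 1 / ε ^ 2) * (ε ^ 2 * ((z + u) ⬝ᵥ (z + u)) + u ⬝ᵥ u) - z ⬝ᵥ z =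
      1 / ε ^ 2 * ((ε ^ 2 • (z + u) + u) ⬝ᵥ (ε ^ 2 • (z + u) + u)) := by
    simp only [add_dotProduct, dotProduct_add, smul_dotProduct, dotProduct_smul, smul_eq_mul,
      dotProduct_comm u z]
    field_simp
    ring
  have h4 : 0 ≤ 1 / ε ^ 2 * ((ε ^ 2 • (z + u) + u) ⬝ᵥ (ε ^ 2 • (z + u) + u)) := by positivity
  linarith

end Blocks

/-! ### Bounds on costs and their ratios -/

section Costs

variable {q : ℕ} {n : Fin q → ℕ}

theorem le_cost (P : Plant n) (K : Mat n) :
    ENNReal.ofReal (state P K 1 ⬝ᵥ state P K 1 + input P K 0 ⬝ᵥ input P K 0) ≤ cost P K := by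
  rw [ENNReal.ofReal_add (dotProduct_self_nonneg _) (dotProduct_self_nonneg _)]
  exact add_le_add (ENNReal.le_tsum (f := fun k =>
    ENNReal.ofReal (state P K (k + 1) ⬝ᵥ state P K (k + 1))) 0)
    (ENNReal.le_tsum (f := fun k => ENNReal.ofReal (input P K k ⬝ᵥ input P K k)) 0)

/-- A nonnegative function that drops by at least the stage cost in each step bounds the cost. -/
theorem cost_le_of_decrease (P : Plant n) (K : Mat n) (v : ℕ → ℝ) (hv : ∀ k, 0 ≤ v k)
    (h : ∀ k, state P K (k + 1) ⬝ᵥ state P K (k + 1) + input P K k ⬝ᵥ input P K k + v (k + 1) ≤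
      v k) : cost P K ≤ ENNReal.ofReal (v 0) := by
  have hc : cost P K = ∑' k, ENNReal.ofReal
      (state P K (k + 1) ⬝ᵥ state P K (k + 1) + input P K k ⬝ᵥ input P K k) := by
    rw [cost, ← ENNReal.tsum_add]
    exact tsum_congr fun k =>
      (ENNReal.ofReal_add (dotProduct_self_nonneg _) (dotProduct_self_nonneg _)).symm
  rw [hc]
  refine ENNReal.tsum_le_of_sum_range_le fun N => ?_
  rw [← ENNReal.ofReal_sum_of_nonneg fun k _ =>
    add_nonneg (dotProduct_self_nonneg _) (dotProduct_self_nonneg _)]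
  refine ENNReal.ofReal_le_ofReal ?_
  have hN : ∑ k ∈ Finset.range N, (state P K (k + 1) ⬝ᵥ state P K (k + 1) +
      input P K k ⬝ᵥ input P K k) + v N ≤ v 0 := by
    induction N with
    | zero => simp
    | succ N ih =>
      rw [Finset.sum_range_succ]
      linarith [h N]
  linarith [hv N]

theorem costRatio_le {a b : ℝ≥0∞} {c : ℝ} (hc : 1 ≤ c) (h : a ≤ ENNReal.ofReal c * b) :
    costRatio a b ≤ ENNReal.ofReal c := by
  rw [costRatio]
  split_ifs with h0
  -- The convention `0 / 0 = 1` is what forces `1 ≤ c`.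
  · exact ENNReal.one_le_ofReal.2 hc
  · exact ENNReal.div_le_of_le_mul h

theorem le_costRatio {a b : ℝ≥0∞} {x y : ℝ} (hx : 0 < x) (hy : 0 < y)
    (ha : ENNReal.ofReal x ≤ a) (hb : b ≤ ENNReal.ofReal y) :
    ENNReal.ofReal (x / y) ≤ costRatio a b := by
  have h0 : ¬ (a = 0 ∧ b = 0) := fun h =>
    ((ENNReal.ofReal_pos.2 hx).trans_le ha).ne' h.1
  rw [costRatio, if_neg h0, ENNReal.ofReal_div_of_pos hy]
  exact ENNReal.div_le_div ha hb

end Costs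

end LimitedModelInfo

namespace LimitedModelInfo

/-! ### Upper bounds for `Γ^Θ`, and the trivial lower bound 1 -/

section ThetaMethod

variable {q : ℕ} {n : Fin q → ℕ}

theorem block_eq_zero_of_not_adj {G : Digraph (Fin q)} {A : Mat n} (hA : A ∈ structured n G)
    {i j : Fin q} (h : ¬ G.Adj j i) : block A i j = 0 :=
  hA i j (by simp [adjacency, h])

theorem block_eq_zero_of_isSink {G : Digraph (Fin q)} {A : Mat n} (hA : A ∈ structured n G)
    {i j : Fin q} (hj : IsSink G j) (hij : i ≠ j) : block A i j = 0 :=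
  block_eq_zero_of_not_adj hA fun h => hj ⟨i, hij, h⟩

open Classical in
/-- The cost that the subsystem `i` causes under `Γ^Θ` if it starts from the predicted state `y`. -/
noncomputable def subsystemCost (G : Digraph (Fin q)) (A B : Mat n) (i : Fin q)
    (y : Fin (n i) → ℝ) : ℝ :=
  if IsSink G i then y ⬝ᵥ valueMatrix (block B i i) (riccati (block A i i) (block B i i)) *ᵥ y
  else ((block B i i)⁻¹ *ᵥ y) ⬝ᵥ ((block B i i)⁻¹ *ᵥ y)

theorem subsystemCost_nonneg {G : Digraph (Fin q)} {A B : Mat n} {i : Fin q}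
    (hB : IsUnit (block B i i).det) (y : Fin (n i) → ℝ) : 0 ≤ subsystemCost G A B i y := by
  rw [subsystemCost]
  split_ifs
  · exact valueMatrix_nonneg (riccati_spec _ hB).1 _ _
  · exact dotProduct_self_nonneg _

theorem subsystemCost_le_inv {G : Digraph (Fin q)} {A B : Mat n} {i : Fin q}
    (hB : IsUnit (block B i i).det) (y : Fin (n i) → ℝ) :
    subsystemCost G A B i y ≤ ((block B i i)⁻¹ *ᵥ y) ⬝ᵥ ((block B i i)⁻¹ *ᵥ y) := by
  rw [subsystemCost]
  split_ifs
  · exact valueMatrix_le_inv (riccati_spec _ hB).1 hB _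
  · exact le_rfl

theorem subsystemCost_zero (G : Digraph (Fin q)) (A B : Mat n) (i : Fin q) :
    subsystemCost G A B i 0 = 0 := by
  simp [subsystemCost]

open Classical in
theorem part_thetaMethod_mulVec (G : Digraph (Fin q)) (A B : Mat n) (x : Idx n → ℝ) (i : Fin q) :
    part (thetaMethod G A B *ᵥ x) i =
      -((if IsSink G i then sinkGain A B i else (block B i i)⁻¹) *ᵥ part (A *ᵥ x) i) := by
  rw [thetaMethod, Matrix.neg_mulVec, part_neg, ← Matrix.mulVec_mulVec, part_blockDiagonal'_mulVec]

/-- One step of the closed loop under `Γ^Θ`. -/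
theorem theta_step {G : Digraph (Fin q)} {A B : Mat n} (hA : A ∈ structured n G)
    (hB : ∀ i j, i ≠ j → block B i j = 0) (hdet : ∀ i, IsUnit (block B i i).det)
    (x : Idx n → ℝ) {u x' : Idx n → ℝ} (hu : u = thetaMethod G A B *ᵥ x)
    (hx' : x' = A *ᵥ x + B *ᵥ u) :
    x' ⬝ᵥ x' + u ⬝ᵥ u + ∑ i, subsystemCost G A B i (part (A *ᵥ x') i) =
      ∑ i, subsystemCost G A B i (part (A *ᵥ x) i) := by
  have hxp : ∀ i, part x' i = part (A *ᵥ x) i + block B i i *ᵥ part u i := fun i => by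
    rw [hx', part_add, part_mulVec_of_blockDiagonal hB]
  have hup := fun i => hu ▸ part_thetaMethod_mulVec G A B x i
  -- Non-sinks are deadbeat.
  have hns : ∀ i, ¬ IsSink G i → part x' i = 0 := fun i hi => by
    rw [hxp, hup, if_neg hi, Matrix.mulVec_neg, Matrix.mulVec_mulVec,
      Matrix.mul_nonsing_inv _ (hdet i), Matrix.one_mulVec, add_neg_cancel]
  -- Decoupling: a sink has no outgoing link, and a non-sink now has nothing to send.
  have hoff : ∀ i j, j ≠ i → block A i j *ᵥ part x' j = 0 := fun i j hij => by
    by_cases hj : IsSink G j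
    · rw [block_eq_zero_of_isSink hA hj hij.symm, Matrix.zero_mulVec]
    · rw [hns j hj, Matrix.mulVec_zero]
  have hAx : ∀ i, part (A *ᵥ x') i = block A i i *ᵥ part x' i := fun i =>
    part_mulVec_of_block_eq_zero x' (hoff i)
  rw [dotProduct_eq_sum_part, dotProduct_eq_sum_part, ← Finset.sum_add_distrib,
    ← Finset.sum_add_distrib]
  refine Finset.sum_congr rfl fun i _ => ?_
  by_cases hi : IsSink G i
  · have hP := (riccati_spec (block A i i) (hdet i)).1
    have hui : part u i = -(feedbackGain (block B i i) (riccati (block A i i) (block B i i)) *ᵥ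
        part (A *ᵥ x) i) := by
      rw [hup, if_pos hi]
      rfl
    have h1 := valueMatrix_eq hP (block B i i) (part (A *ᵥ x) i)
    -- The Riccati equation splits `x'ᵀ X x'` into the stage cost `|x'|²` and the value of the next
    -- predicted state `A_ii x'`.
    rw [sub_eq_add_neg, ← Matrix.mulVec_neg, ← hui, ← hxp, riccati_form (hdet i),
      ← neg_dotProduct_neg (feedbackGain _ _ *ᵥ _), ← hui] at h1
    rw [subsystemCost, if_pos hi, subsystemCost, if_pos hi, hAx, h1]
    ring
  · rw [hAx, hns i hi, Matrix.mulVec_zero, subsystemCost_zero, dotProduct_zero, hup, if_neg hi,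
      neg_dotProduct_neg, subsystemCost, if_neg hi]
    ring

theorem theta_cost_le {G : Digraph (Fin q)} {P : Plant n} (hA : P.A ∈ structured n G)
    (hB : ∀ i j, i ≠ j → block P.B i j = 0) (hdet : ∀ i, IsUnit (block P.B i i).det) :
    cost P (thetaMethod G P.A P.B) ≤
      ENNReal.ofReal (∑ i, subsystemCost G P.A P.B i (part (P.A *ᵥ P.x₀) i)) :=
  cost_le_of_decrease P _
    (fun k => ∑ i, subsystemCost G P.A P.B i
      (part (P.A *ᵥ state P (thetaMethod G P.A P.B) k) i))
    (fun _ => Finset.sum_nonneg fun i _ => subsystemCost_nonneg (hdet i) _)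
    (fun k => (theta_step hA hB hdet (state P (thetaMethod G P.A P.B) k) rfl rfl).le)

/-- Bounding the optimal cost by its first stage ignores the structure of `K`; as `B` is
block-diagonal, that stage splits over subsystems, each with a free input `u`. -/
theorem theta_costRatio_le {GP : Digraph (Fin q)} (GK : Digraph (Fin q)) {P : Plant n}
    (hA : P.A ∈ structured n GP) (hB : ∀ i j, i ≠ j → block P.B i j = 0)
    (hdet : ∀ i, IsUnit (block P.B i i).det) {c : ℝ} (hc : 1 ≤ c)
    (h : ∀ i u, subsystemCost GP P.A P.B i (part (P.A *ᵥ P.x₀) i) ≤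
      c * ((part (P.A *ᵥ P.x₀) i + block P.B i i *ᵥ u) ⬝ᵥ
        (part (P.A *ᵥ P.x₀) i + block P.B i i *ᵥ u) + u ⬝ᵥ u)) :
    costRatio (cost P (thetaMethod GP P.A P.B)) (optimalCost GK P) ≤ ENNReal.ofReal c := by
  have hc0 : 0 ≤ c := zero_le_one.trans hc
  have hcpos : ENNReal.ofReal c ≠ 0 := (ENNReal.ofReal_pos.2 (one_pos.trans_le hc)).ne'
  refine costRatio_le hc ?_
  -- Dividing by `c` lets the bound be checked under the infimum, one controller at a time.
  rw [optimalCost, mul_comm, ← ENNReal.div_le_iff_le_mul (.inl hcpos) (.inl ENNReal.ofReal_ne_top)]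
  refine le_iInf₂ fun K _ => ?_
  rw [ENNReal.div_le_iff_le_mul (.inl hcpos) (.inl ENNReal.ofReal_ne_top), mul_comm]
  refine (theta_cost_le hA hB hdet).trans
    (le_trans ?_ (mul_le_mul_right (le_cost P K) (ENNReal.ofReal c)))
  rw [← ENNReal.ofReal_mul hc0]
  refine ENNReal.ofReal_le_ofReal ?_
  rw [dotProduct_eq_sum_part, dotProduct_eq_sum_part, ← Finset.sum_add_distrib, Finset.mul_sum]
  refine Finset.sum_le_sum fun i _ => ?_
  have hx : part (state P K 1) i =
      part (P.A *ᵥ P.x₀) i + block P.B i i *ᵥ part (input P K 0) i := by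
    rw [← part_mulVec_of_blockDiagonal hB]
    rfl
  rw [hx]
  exact h i _

/-- The inverse gains `B_ii⁻¹` make the competitive ratio of `Γ^Θ` at most `1 + 1 / ε²`. -/
theorem competitiveRatio_theta_le (GP GK : Digraph (Fin q)) {ε : ℝ} (hε : 0 < ε) {𝓑 : Set (Mat n)}
    (h𝓑 : 𝓑 = blockInputs n ε ∨ 𝓑 = diagonalInputs n ε) :
    competitiveRatio GP GK 𝓑 (thetaMethod GP) ≤ ENNReal.ofReal (1 + 1 / ε ^ 2) := by
  refine iSup₂_le fun P hP => ?_
  obtain ⟨hB, hb⟩ := inputs_spec hε h𝓑 hP.2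
  have hdet := fun i => isUnit_det_of_bound hε (block_bound hB hb i)
  have hpos : 0 ≤ 1 / ε ^ 2 := by positivity
  exact theta_costRatio_le GK hP.1 hB hdet (by linarith) fun i u =>
    (subsystemCost_le_inv (hdet i) _).trans (inv_mulVec_le hε (block_bound hB hb i) _ u)

theorem not_adj_of_adjacency11 {G : Digraph (Fin q)} (h : adjacency11 G = 0) {i j : Fin q}
    (hi : ¬ IsSink G i) (hj : ¬ IsSink G j) : ¬ G.Adj j i := by
  simpa [adjacency11, adjacency] using congrFun (congrFun h ⟨i, hi⟩) ⟨j, hj⟩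

theorem not_adj_of_adjacency22 {G : Digraph (Fin q)} (h : adjacency22 G = 0) {i j : Fin q}
    (hi : IsSink G i) (hj : IsSink G j) : ¬ G.Adj j i := by
  simpa [adjacency22, adjacency] using congrFun (congrFun h ⟨i, hi⟩) ⟨j, hj⟩

theorem exists_adj_of_adjacency11 {G : Digraph (Fin q)} (h : adjacency11 G ≠ 0) :
    ∃ i j, ¬ IsSink G i ∧ G.Adj j i := by
  by_contra! h'
  refine h ?_
  ext i j
  simpa [adjacency11, adjacency] using h' i j i.2

/-- Without edges between non-sinks and without loops at sinks, `Γ^Θ` is optimal. -/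
theorem competitiveRatio_theta_le_one {GP : Digraph (Fin q)} (GK : Digraph (Fin q))
    (h11 : adjacency11 GP = 0) (h22 : adjacency22 GP = 0) {ε : ℝ} (hε : 0 < ε) {𝓑 : Set (Mat n)}
    (h𝓑 : 𝓑 = blockInputs n ε ∨ 𝓑 = diagonalInputs n ε) :
    competitiveRatio GP GK 𝓑 (thetaMethod GP) ≤ 1 := by
  refine iSup₂_le fun P hP => ?_
  obtain ⟨hB, hb⟩ := inputs_spec hε h𝓑 hP.2
  have hdet := fun i => isUnit_det_of_bound hε (block_bound hB hb i)
  rw [← ENNReal.ofReal_one]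
  refine theta_costRatio_le GK hP.1 hB hdet le_rfl fun i u => ?_
  rw [one_mul]
  by_cases hi : IsSink GP i
  · have hAii : block P.A i i = 0 :=
      block_eq_zero_of_not_adj hP.1 (not_adj_of_adjacency22 h22 hi hi)
    -- With `X = 1` the value matrix gives exactly the one-stage minimum.
    rw [subsystemCost, if_pos hi, hAii, riccati_zero (hdet i)]
    simpa using valueMatrix_le Matrix.PosDef.one (block P.B i i) (part (P.A *ᵥ P.x₀) i) u
  · have hy : part (P.A *ᵥ P.x₀) i = 0 := by
      rw [part_mulVec]
      refine Finset.sum_eq_zero fun j _ => ?_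
      rw [block_eq_zero_of_not_adj hP.1, Matrix.zero_mulVec]
      by_cases hj : IsSink GP j
      · exact fun h => hj ⟨i, fun hij => hi (hij ▸ hj), h⟩
      · exact not_adj_of_adjacency11 h11 hi hj
    rw [hy, subsystemCost_zero]
    exact add_nonneg (dotProduct_self_nonneg _) (dotProduct_self_nonneg _)

/-- A plant at rest has both costs zero, and `0 / 0 = 1`. -/
theorem one_le_competitiveRatio_theta {GP GK : Digraph (Fin q)} (hGK : GP ≤ GK) {ε : ℝ}
    (hε : 0 < ε) {𝓑 : Set (Mat n)} (h𝓑 : 𝓑 = blockInputs n ε ∨ 𝓑 = diagonalInputs n ε) :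
    1 ≤ competitiveRatio GP GK 𝓑 (thetaMethod GP) := by
  have h0 : (0 : Mat n) ∈ structured n GP := fun _ _ _ => rfl
  let P : Plant n := ⟨0, ε • 1, 0⟩
  have hx : ∀ k, state P (thetaMethod GP P.A P.B) k = 0 := by
    intro k
    induction k with
    | zero => rfl
    | succ k ih => rw [state, ih]; simp
  have hc : cost P (thetaMethod GP P.A P.B) = 0 := by simp [cost, input, hx]
  have ho : optimalCost GK P = 0 :=
    le_antisymm ((iInf₂_le _ (thetaMethod_mem hGK h0 P.B)).trans hc.le) zero_le
  refine le_trans ?_ (le_iSup₂ P ⟨h0, smul_one_mem_inputs hε h𝓑⟩)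
  rw [costRatio, if_pos ⟨hc, ho⟩]

end ThetaMethod

/-! ### Lower bound from plants with a single link -/

section LowerBound

variable {q : ℕ} {n : Fin q → ℕ}

theorem single_mem_structured {G : Digraph (Fin q)} {i j : Fin q} (h : G.Adj j i) (a : Fin (n i))
    (b : Fin (n j)) (s : ℝ) : (Matrix.single ⟨i, a⟩ ⟨j, b⟩ s : Mat n) ∈ structured n G := by
  intro k l hkl
  have hkl' : ¬ G.Adj l k := by simpa [adjacency] using hkl
  ext c d
  refine Matrix.single_apply_of_ne _ _ _ _ _ ?_
  rintro ⟨h1, h2⟩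
  obtain rfl : i = k := congrArg Sigma.fst h1
  obtain rfl : j = l := congrArg Sigma.fst h2
  exact hkl' h

theorem smul_mem_structured {G : Digraph (Fin q)} {M : Mat n} (hM : M ∈ structured n G) (c : ℝ) :
    c • M ∈ structured n G := by
  intro i j hij
  ext a b
  have : M ⟨i, a⟩ ⟨j, b⟩ = 0 := congrFun (congrFun (hM i j hij) a) b
  simp [block, this]

/-- The plant with a single link of gain `s` that starts at the source of the link. -/
def linkPlant (ε s : ℝ) (p r : Idx n) : Plant n where
  A := Matrix.single p r s
  B := ε • 1
  x₀ := Pi.single r 1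

theorem single_mulVec_eq (p r : Idx n) (s : ℝ) (x : Idx n → ℝ) :
    (Matrix.single p r s : Mat n) *ᵥ x = (s * x r) • Pi.single p 1 := by
  rw [Matrix.single_mulVec]
  ext t
  simp [Function.update_apply, Pi.single_apply]

/-- The deadbeat gain at the non-sink `i` is `ε⁻¹`, so the first input already has entry `-s/ε`. -/
theorem linkPlant_theta_cost {G : Digraph (Fin q)} {i : Fin q} (hi : ¬ IsSink G i) (a : Fin (n i))
    (r : Idx n) {ε : ℝ} (hε : 0 < ε) (s : ℝ) :
    ENNReal.ofReal (s ^ 2 / ε ^ 2) ≤ cost (linkPlant ε s ⟨i, a⟩ r)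
      (thetaMethod G (linkPlant ε s ⟨i, a⟩ r).A (linkPlant ε s ⟨i, a⟩ r).B) := by
  refine le_trans (ENNReal.ofReal_le_ofReal ?_) (le_cost _ _)
  set P := linkPlant ε s ⟨i, a⟩ r with hP
  have hinv : (block P.B i i)⁻¹ = ε⁻¹ • 1 := by
    have hb : block P.B i i = ε • 1 := by
      ext c d
      simp [hP, linkPlant, block, Matrix.one_apply]
    rw [hb]
    exact Matrix.inv_eq_right_inv (by simp [smul_smul, inv_mul_cancel₀ hε.ne'])
  have hu : part (input P (thetaMethod G P.A P.B) 0) i = -(ε⁻¹ • part (P.A *ᵥ P.x₀) i) := by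
    rw [input, part_thetaMethod_mulVec, if_neg hi, hinv, Matrix.smul_mulVec, Matrix.one_mulVec]
    rfl
  have hua : input P (thetaMethod G P.A P.B) 0 ⟨i, a⟩ = -(ε⁻¹ * s) := by
    have h1 := congrFun hu a
    have h2 : P.A *ᵥ P.x₀ = (s * 1) • Pi.single ⟨i, a⟩ 1 := by
      simp only [hP, linkPlant, single_mulVec_eq, Pi.single_eq_same]
    rw [h2] at h1
    simpa [part] using h1
  have h3 : input P (thetaMethod G P.A P.B) 0 ⟨i, a⟩ * input P (thetaMethod G P.A P.B) 0 ⟨i, a⟩ ≤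
      input P (thetaMethod G P.A P.B) 0 ⬝ᵥ input P (thetaMethod G P.A P.B) 0 :=
    Finset.single_le_sum (f := fun t => input P (thetaMethod G P.A P.B) 0 t *
      input P (thetaMethod G P.A P.B) 0 t) (fun t _ => mul_self_nonneg _) (Finset.mem_univ _)
  rw [hua] at h3
  have h4 : -(ε⁻¹ * s) * -(ε⁻¹ * s) = s ^ 2 / ε ^ 2 := by field_simp
  linarith [dotProduct_self_nonneg (state P (thetaMethod G P.A P.B) 1)]

theorem linkPlant_optimalCost_le {G : Digraph (Fin q)} {i j : Fin q} (h : G.Adj j i) (a : Fin (n i))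
    (b : Fin (n j)) (ε : ℝ) {s : ℝ} (hs : s ^ 2 < 1) :
    optimalCost G (linkPlant ε s ⟨i, a⟩ ⟨j, b⟩) ≤
      ENNReal.ofReal (s ^ 2 / ((1 + ε ^ 2) * (1 - s ^ 2))) := by
  set P := linkPlant ε s ⟨i, a⟩ ⟨j, b⟩ with hP
  set p : Idx n := ⟨i, a⟩
  set r : Idx n := ⟨j, b⟩
  -- The factor `-ε/(1 + ε²)` minimises `(y + ε u)² + u²` over `u`, with minimum `y²/(1 + ε²)`.
  set K : Mat n := (-(ε / (1 + ε ^ 2))) • Matrix.single p r s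
  have hK : K ∈ structured n G := smul_mem_structured (single_mem_structured h a b s) _
  have hs' : 0 < 1 - s ^ 2 := by linarith
  have hε' : 0 < 1 + ε ^ 2 := by positivity
  -- The sum of a geometric series with ratio `s²`: a self-loop (`p = r`) may keep the state alive,
  -- shrinking at least by the factor `s` per step.
  set c := s ^ 2 / ((1 + ε ^ 2) * (1 - s ^ 2)) with hc
  have hc0 : 0 ≤ c := by positivity
  have hcs : c * (1 - s ^ 2) = s ^ 2 / (1 + ε ^ 2) := by rw [hc]; field_simp
  have hu : ∀ k, input P K k =
      (-(ε / (1 + ε ^ 2)) * (s * state P K k r)) • (Pi.single p 1 : Idx n → ℝ) := fun k => by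
    rw [input, Matrix.smul_mulVec, single_mulVec_eq, smul_smul]
  have hx : ∀ k, state P K (k + 1) =
      (s * state P K k r / (1 + ε ^ 2)) • (Pi.single p 1 : Idx n → ℝ) := fun k => by
    have h1 : state P K (k + 1) = P.A *ᵥ state P K k + P.B *ᵥ input P K k := rfl
    have h2 : P.A *ᵥ state P K k = (s * state P K k r) • (Pi.single p 1 : Idx n → ℝ) :=
      single_mulVec_eq _ _ _ _
    have h3 : P.B *ᵥ input P K k = ε • input P K k := by
      simp [hP, linkPlant, Matrix.smul_mulVec]
    rw [h1, h2, h3, hu, smul_smul, ← add_smul]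
    congr 1
    field_simp
    ring
  have hcost := cost_le_of_decrease P K (fun k => c * state P K k r ^ 2)
    (fun k => by positivity) fun k => by
      have h1 : state P K (k + 1) r ^ 2 ≤ s ^ 2 * state P K k r ^ 2 := by
        rw [hx]
        rw [← mul_pow, sq_le_sq, Pi.smul_apply, smul_eq_mul, abs_mul, abs_div, abs_of_pos hε']
        have h2 : |(Pi.single p 1 : Idx n → ℝ) r| ≤ 1 := by
          rw [Pi.single_apply]
          split_ifs <;> simp
        have h3 : |s * state P K k r| / (1 + ε ^ 2) ≤ |s * state P K k r| :=
          div_le_self (abs_nonneg _) (by linarith [sq_nonneg ε])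
        exact (mul_le_of_le_one_right (by positivity) h2).trans h3
      have h4 : state P K (k + 1) ⬝ᵥ state P K (k + 1) + input P K k ⬝ᵥ input P K k =
          c * (1 - s ^ 2) * state P K k r ^ 2 := by
        rw [hx, hu, hcs]
        simp only [smul_dotProduct, dotProduct_smul, single_one_dotProduct, Pi.single_eq_same,
          smul_eq_mul]
        field_simp
      rw [h4]
      nlinarith [mul_le_mul_of_nonneg_left h1 hc0]
  refine (iInf₂_le K hK).trans (hcost.trans (ENNReal.ofReal_le_ofReal ?_))
  have : state P K 0 r = 1 := by simp [state, hP, linkPlant, r]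
  simp [this]

open Filter Topology in
/-- A link into a non-sink makes the competitive ratio of `Γ^Θ` at least `1 + 1 / ε²`. -/
theorem le_competitiveRatio_theta (hn : ∀ i, 1 ≤ n i) {GP GK : Digraph (Fin q)} (hGK : GP ≤ GK)
    (h11 : adjacency11 GP ≠ 0) {ε : ℝ} (hε : 0 < ε) {𝓑 : Set (Mat n)}
    (h𝓑 : 𝓑 = blockInputs n ε ∨ 𝓑 = diagonalInputs n ε) :
    ENNReal.ofReal (1 + 1 / ε ^ 2) ≤ competitiveRatio GP GK 𝓑 (thetaMethod GP) := by
  obtain ⟨i, j, hi, hij⟩ := exists_adj_of_adjacency11 h11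
  let a : Fin (n i) := ⟨0, hn i⟩
  let b : Fin (n j) := ⟨0, hn j⟩
  -- The function of `s` is the quotient of the two cost bounds for the link plant.
  have hlim : Tendsto (fun s : ℝ => ENNReal.ofReal ((1 + 1 / ε ^ 2) * (1 - s ^ 2))) (𝓝[>] 0)
      (𝓝 (ENNReal.ofReal (1 + 1 / ε ^ 2))) := by
    have h1 : Continuous fun s : ℝ => ENNReal.ofReal ((1 + 1 / ε ^ 2) * (1 - s ^ 2)) :=
      ENNReal.continuous_ofReal.comp (by fun_prop)
    have h2 := h1.tendsto 0
    simp only [ne_eq, OfNat.ofNat_ne_zero, not_false_eq_true, zero_pow, sub_zero, mul_one] at h2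
    exact h2.mono_left nhdsWithin_le_nhds
  refine le_of_tendsto hlim ?_
  filter_upwards [Ioo_mem_nhdsGT one_pos] with s hs
  have hs1 : s ^ 2 < 1 := by nlinarith [hs.1, hs.2]
  have hs0 : 0 < s := hs.1
  have hs' : 0 < 1 - s ^ 2 := by linarith
  refine le_trans ?_ (le_iSup₂ (linkPlant ε s ⟨i, a⟩ ⟨j, b⟩)
    ⟨single_mem_structured hij a b s, smul_one_mem_inputs hε h𝓑⟩)
  refine le_trans (ENNReal.ofReal_le_ofReal (le_of_eq ?_))
    (le_costRatio (by positivity : 0 < s ^ 2 / ε ^ 2)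
      (by positivity : 0 < s ^ 2 / ((1 + ε ^ 2) * (1 - s ^ 2)))
      (linkPlant_theta_cost hi a ⟨j, b⟩ hε s) (linkPlant_optimalCost_le (hGK hij) a b ε hs1))
  field_simp
  ring

end LowerBound

end LimitedModelInfo

theorem mainTheorem5 {q : ℕ} (n : Fin q → ℕ) (hn : ∀ i, 1 ≤ n i)
    (GP GK : Digraph (Fin q)) (hGK : GP ≤ GK)
    (hisolated : ∀ i, ¬ LimitedModelInfo.IsIsolated GP i)
    (hsink : ∃ i, LimitedModelInfo.IsSink GP i)
    (ε : ℝ) (hε : 0 < ε) (𝓑 : Set (LimitedModelInfo.Mat n))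
    (h𝓑 : 𝓑 = LimitedModelInfo.blockInputs n ε ∨ 𝓑 = LimitedModelInfo.diagonalInputs n ε) :
    (LimitedModelInfo.adjacency11 GP = 0 ∧ LimitedModelInfo.adjacency22 GP = 0 →
      LimitedModelInfo.competitiveRatio GP GK 𝓑 (LimitedModelInfo.thetaMethod GP) = 1) ∧
    (LimitedModelInfo.adjacency11 GP ≠ 0 →
      LimitedModelInfo.competitiveRatio GP GK 𝓑 (LimitedModelInfo.thetaMethod GP) =
        ENNReal.ofReal (1 + 1 / ε ^ 2)) :=
  ⟨fun h => le_antisymm (LimitedModelInfo.competitiveRatio_theta_le_one GK h.1 h.2 hε h𝓑)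
      (LimitedModelInfo.one_le_competitiveRatio_theta hGK hε h𝓑),
    fun h => le_antisymm (LimitedModelInfo.competitiveRatio_theta_le GP GK hε h𝓑)
      (LimitedModelInfo.le_competitiveRatio_theta hn hGK h hε h𝓑)⟩
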